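/- Let $r_m$ be $1$ plus the exponent of $2$ in the prime factorization of $m$. For integers $\alpha,\beta$, a nondecreasing sequence $A(1),A(2),\dots$ of positive integers is called $(\alpha,\beta)$-Conolly if every positive integer $m$ occurs in it exactly $\alpha+\beta r_m$ times. For an integer $p\ge 1$, a 2-ary meta-Fibonacci recursion of order $p$ is a recursion $$R(n)=R\Bigl(n-s-\sum_{j=1}^p R(n-a_j)\Bigr)+R\Bigl(n-t-\sum_{j=1}^p R(n-b_j)\Bigr)$$ with integer constants $s,t\ge 0$ and $a_j,b_j\ge 1$; it is denoted $\langle s;a_1,\dots,a_p : t;b_1,\dots,b_p\rangle$. A sequence $A(1),A(2),\dots$ is a solution of it if, for some $c$, the initial values $A(1),\dots,A(c)$ are positive integers and for every $n>c$ all the arguments $n-a_j$, $n-b_j$, $n-s-\sum_j A(n-a_j)$, $n-t-\sum_j A(n-b_j)$ are positive and the recursion holds at $n$. The recursion is called $(\alpha,\beta)$-Conolly if it has an $(\alpha,\beta)$-Conolly solution for at least one choice of initial values. **Theorem.** Let $\alpha,\beta$ be integers, excluding the case $-\alpha=\beta>0$. There exists an $(\alpha,\beta)$-Conolly 2-ary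 meta-Fibonacci recursion (of some order $p\ge 1$) if and only if $\beta\ge 0$, $\alpha+\beta>0$ and $\alpha$ is even. Moreover, if these three conditions hold, then with $\gamma=\alpha+\beta$ and $p=\alpha/2+\beta$ the recursion $$\langle 0;1,3,\dots,2p-1 : \gamma;\gamma+1,\gamma+3,\dots,\gamma+2p-1\rangle$$ is $(\alpha,\beta)$-Conolly. -/

import Mathlib

/-- The ruler function `r_m`: one plus the exponent of `2` in the prime factorization of `m`. -/
def ruler (m : ℕ) : ℕ := padicValNat 2 m + 1

/-- A sequence `A 1, A 2, A 3, …` (the value `A 0` plays no role) is `(α, β)`-Conolly if it is a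
nondecreasing sequence of positive integers in which every positive integer `m` occurs
exactly `α + β * r_m` times. -/
structure IsConollySeq (α β : ℤ) (A : ℕ → ℕ) : Prop where
  pos : ∀ n, 1 ≤ n → 0 < A n
  mono : ∀ m n, 1 ≤ m → m ≤ n → A m ≤ A n
  finite_occurrences : ∀ m, 1 ≤ m → {n : ℕ | 1 ≤ n ∧ A n = m}.Finite
  frequency : ∀ m, 1 ≤ m → (Set.ncard {n : ℕ | 1 ≤ n ∧ A n = m} : ℤ) = α + β * (ruler m : ℤ)

/-- The parameters of a `k`-ary meta-Fibonacci recursion of order `p`,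
`R(n) = ∑ i, R(n - s_i - ∑ j, R(n - a_{ij}))`, with `s_i ≥ 0` and `a_{ij} ≥ 1`. -/
structure MetaFib (k p : ℕ) where
  s : Fin k → ℕ
  a : Fin k → Fin p → ℕ
  a_pos : ∀ i j, 1 ≤ a i j

/-- `A 1, A 2, …` is the solution of the recursion `R` with the `c` positive initial values
`A 1, …, A c`: for every `n > c` all the arguments `n - a_{ij}` and
`n - s_i - ∑ j, A(n - a_{ij})` are positive (so that the subtractions below are exact), and `A n`
is given by the recursion. -/
structure MetaFib.IsSolution {k p : ℕ} (R : MetaFib k p) (c : ℕ) (A : ℕ → ℕ) : Prop where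
  initial_pos : ∀ n, 1 ≤ n → n ≤ c → 0 < A n
  inner_arg_pos : ∀ n, c < n → ∀ i j, R.a i j < n
  outer_arg_pos : ∀ n, c < n → ∀ i, R.s i + ∑ j, A (n - R.a i j) < n
  recursion : ∀ n, c < n → A n = ∑ i, A (n - (R.s i + ∑ j, A (n - R.a i j)))

/-- A recursion is `(α, β)`-Conolly if, for at least one choice of finitely many initial
conditions, its solution is an `(α, β)`-Conolly sequence. -/
def MetaFib.IsConolly {k p : ℕ} (R : MetaFib k p) (α β : ℤ) : Prop :=
  ∃ (c : ℕ) (A : ℕ → ℕ), R.IsSolution c A ∧ IsConollySeq α β A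

/-- The recursion `⟨0; 1, 3, …, 2p-1 : γ; γ+1, γ+3, …, γ+2p-1⟩`. -/
def oddLagRecursion (p γ : ℕ) : MetaFib 2 p where
  s := ![0, γ]
  a := fun i j => ![0, γ] i + (2 * (j : ℕ) + 1)
  a_pos := fun i j => by omega

/-! Write γ = α + β, δ = γ + β, and let N be the counting function `conollyCount`. For γ > 0, being
Conolly amounts to `A n ≤ m ↔ n ≤ N m`, and N satisfies N(2k) = N(k) + δk.

Sufficiency: with 2p = δ, this identity makes the odd-lag term equal ⌈A n / 2⌉ (`odd_lags_half`).
Delaying by γ gives ⌊A n / 2⌋ (`half_sub_eq`), and the two add up to A n.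

Necessity: A n = n/δ + O(log n), so each outer argument is (1 - p/δ)n + O(log n). Comparing leading
terms in the recursion gives 2(δ - p) = δ, so α = 2p - 2β is even (`two_mul_order_eq`). -/

/-- The number of occurrences of `m` in an `(γ - β, β)`-Conolly sequence. -/
def conollyFreq (γ β m : ℕ) : ℕ := γ + β * padicValNat 2 m

/-- The number of terms that are at most `m` in an `(γ - β, β)`-Conolly sequence. -/
def conollyCount (γ β m : ℕ) : ℕ := ∑ i ∈ Finset.range m, conollyFreq γ β (i + 1)

/-! ### The counting function -/

theorem conollyCount_succ (γ β m : ℕ) :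
    conollyCount γ β (m + 1) = conollyCount γ β m + conollyFreq γ β (m + 1) :=
  Finset.sum_range_succ _ _

theorem conollyCount_zero (γ β : ℕ) : conollyCount γ β 0 = 0 := rfl

theorem conollyFreq_odd (γ β k : ℕ) : conollyFreq γ β (2 * k + 1) = γ := by
  rw [conollyFreq, padicValNat.eq_zero_of_not_dvd (by omega), mul_zero, add_zero]

theorem conollyFreq_two_mul (γ β k : ℕ) :
    conollyFreq γ β (2 * (k + 1)) = conollyFreq γ β (k + 1) + β := by
  rw [conollyFreq, conollyFreq, padicValNat.mul (by norm_num) (by omega),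
    padicValNat.self (by norm_num)]
  ring

theorem le_conollyFreq (γ β m : ℕ) : γ ≤ conollyFreq γ β m := Nat.le_add_right _ _

theorem conollyCount_two_mul (γ β k : ℕ) :
    conollyCount γ β (2 * k) = conollyCount γ β k + (γ + β) * k := by
  induction k with
  | zero => simp [conollyCount_zero]
  | succ k ih =>
    have h : 2 * (k + 1) = 2 * k + 1 + 1 := by ring
    have h2 := conollyFreq_two_mul γ β k
    rw [h] at h2
    rw [h, conollyCount_succ, conollyCount_succ, ih, conollyCount_succ, conollyFreq_odd, h2]
    ring

theorem conollyCount_two_mul_add_one (γ β k : ℕ) :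
    conollyCount γ β (2 * k + 1) = conollyCount γ β k + (γ + β) * k + γ := by
  rw [conollyCount_succ, conollyCount_two_mul, conollyFreq_odd]

theorem conollyCount_strictMono {γ : ℕ} (hγ : 0 < γ) (β : ℕ) :
    StrictMono (conollyCount γ β) :=
  strictMono_nat_of_lt_succ fun m => by
    have := le_conollyFreq γ β (m + 1)
    rw [conollyCount_succ]; omega

theorem conollyCount_le (γ β m : ℕ) : conollyCount γ β m ≤ (γ + β) * m := by
  induction m using Nat.strong_induction_on with
  | _ m ih =>
    obtain ⟨k, rfl | rfl⟩ := Nat.even_or_odd' m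
    · rcases Nat.eq_zero_or_pos k with rfl | hk
      · simp [conollyCount_zero]
      · have := ih k (by omega)
        rw [conollyCount_two_mul]; nlinarith
    · have := ih k (by omega)
      rw [conollyCount_two_mul_add_one]; nlinarith

/-- The deficit (γ + β)m - N(m) is unchanged under m ↦ 2m and grows by β under m ↦ 2m + 1, so it is
β times the number of binary ones of m. -/
theorem le_conollyCount_add (γ β k : ℕ) :
    ∀ m < 2 ^ k, (γ + β) * m ≤ conollyCount γ β m + β * k := by
  induction k with
  | zero => intro m hm; simp_all
  | succ k ih =>
    intro m hm
    rw [pow_succ] at hm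
    obtain ⟨l, rfl | rfl⟩ := Nat.even_or_odd' m
    · have := ih l (by omega)
      rw [conollyCount_two_mul]; nlinarith
    · have := ih l (by omega)
      rw [conollyCount_two_mul_add_one]; nlinarith

/-- The counting function determines the frequencies. -/
theorem conollyFiber_eq {N : ℕ → ℕ} {A : ℕ → ℕ}
    (hA : ∀ n, 1 ≤ n → ∀ m, A n ≤ m ↔ n ≤ N m) (m : ℕ) :
    {n : ℕ | 1 ≤ n ∧ A n = m + 1} = ↑(Finset.Icc (max 1 (N m + 1)) (N (m + 1))) := by
  ext n
  simp only [Set.mem_ofPred_eq, Finset.coe_Icc, Set.mem_Icc]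
  constructor
  · rintro ⟨h1, h2⟩
    have := hA n h1 m
    have := hA n h1 (m + 1)
    omega
  · rintro ⟨h1, h2⟩
    have h1' : 1 ≤ n := by omega
    have := hA n h1' m
    have := hA n h1' (m + 1)
    omega

theorem ruler_frequency_eq {α β : ℤ} {γ b : ℕ} (hα : α + β = γ) (hβ : β = b) (m : ℕ) :
    α + β * (ruler m : ℤ) = conollyFreq γ b m := by
  simp only [ruler, conollyFreq]
  push_cast
  rw [← hα, ← hβ]; ring

theorem isConollySeq_of_le_iff {α β : ℤ} {γ b : ℕ} (hα : α + β = γ)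
    (hβ : β = b) {A : ℕ → ℕ}
    (hA : ∀ n, 1 ≤ n → ∀ m, A n ≤ m ↔ n ≤ conollyCount γ b m) : IsConollySeq α β A where
  pos n hn := by
    have := hA n hn 0
    rw [conollyCount_zero] at this
    omega
  mono m n hm hmn := (hA m hm _).2 (hmn.trans ((hA n (hm.trans hmn) _).1 le_rfl))
  finite_occurrences m hm := by
    obtain ⟨m, rfl⟩ : ∃ k, m = k + 1 := ⟨m - 1, by omega⟩
    rw [conollyFiber_eq hA]
    exact Finset.finite_toSet _
  frequency m hm := by
    obtain ⟨m, rfl⟩ : ∃ k, m = k + 1 := ⟨m - 1, by omega⟩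
    rw [conollyFiber_eq hA, Set.ncard_coe_finset, ruler_frequency_eq hα hβ, Nat.card_Icc,
      conollyCount_succ]
    congr 1
    omega

theorem exists_le_iff_le_conollyCount {γ : ℕ} (hγ : 0 < γ) (β : ℕ) :
    ∃ A : ℕ → ℕ, ∀ n, 1 ≤ n → ∀ m, A n ≤ m ↔ n ≤ conollyCount γ β m := by
  have hN := conollyCount_strictMono hγ β
  have hex : ∀ n, ∃ m, n ≤ conollyCount γ β m := fun n => ⟨n, hN.id_le n⟩
  refine ⟨fun n => Nat.find (hex n), fun n _ m => ⟨fun h => ?_, fun h => Nat.find_min' _ h⟩⟩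
  exact (Nat.find_spec (hex n)).trans (hN.monotone h)

theorem IsConollySeq.le_iff_le_conollyCount {α β : ℤ} {γ b : ℕ} (hα : α + β = γ)
    (hβ : β = b) {A : ℕ → ℕ} (hA : IsConollySeq α β A) (n : ℕ) (hn : 1 ≤ n) (m : ℕ) :
    A n ≤ m ↔ n ≤ conollyCount γ b m := by
  have key : ∀ m, {n : ℕ | 1 ≤ n ∧ A n ≤ m}.Finite ∧
      {n : ℕ | 1 ≤ n ∧ A n ≤ m}.ncard = conollyCount γ b m := by
    intro m
    induction m with
    | zero =>
      have : {n : ℕ | 1 ≤ n ∧ A n ≤ 0} = ∅ := by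
        ext n
        simp only [Set.mem_ofPred_eq, Set.mem_empty_iff_false, iff_false, not_and]
        intro h
        have := hA.pos n h
        omega
      rw [this]
      simp [conollyCount_zero]
    | succ m ih =>
      have hu : {n : ℕ | 1 ≤ n ∧ A n ≤ m + 1} =
          {n : ℕ | 1 ≤ n ∧ A n ≤ m} ∪ {n : ℕ | 1 ≤ n ∧ A n = m + 1} := by
        ext n
        simp only [Set.mem_ofPred_eq, Set.mem_union]
        omega
      have hf := hA.finite_occurrences (m + 1) (by omega)
      have hc := hA.frequency (m + 1) (by omega)
      rw [ruler_frequency_eq hα hβ] at hc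
      rw [hu]
      refine ⟨ih.1.union hf, ?_⟩
      rw [Set.ncard_union_eq _ ih.1 hf, ih.2, conollyCount_succ]
      · congr 1
        exact_mod_cast hc
      · rw [Set.disjoint_left]
        rintro x ⟨_, h1⟩ ⟨_, h2⟩
        omega
  obtain ⟨hfin, hcard⟩ := key m
  have hIcc : ∀ k, (↑(Finset.Icc 1 k) : Set ℕ).ncard = k := fun k => by
    rw [Set.ncard_coe_finset, Nat.card_Icc, Nat.add_sub_cancel]
  constructor
  · intro h
    rw [← hcard, ← hIcc n]
    refine Set.ncard_le_ncard (fun x hx => ?_) hfin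
    rw [Finset.coe_Icc, Set.mem_Icc] at hx
    exact ⟨hx.1, (hA.mono x n hx.1 hx.2).trans h⟩
  · intro h
    by_contra hlt
    have : {n : ℕ | 1 ≤ n ∧ A n ≤ m}.ncard ≤ n - 1 := by
      rw [← hIcc (n - 1)]
      refine Set.ncard_le_ncard (fun x hx => ?_) (Finset.finite_toSet _)
      rw [Finset.coe_Icc, Set.mem_Icc]
      refine ⟨hx.1, ?_⟩
      by_contra hx'
      have := hA.mono n x hn (by omega)
      have := hx.2
      omega
    omega

/-! ### Sufficiency: odd lags -/

theorem sum_fin_ite_odd_lt (p d : ℕ) :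
    ∑ j : Fin p, (if 2 * (j : ℕ) + 1 < d then 1 else 0) = min p (d / 2) := by
  induction p with
  | zero => simp
  | succ p ih =>
    rw [Fin.sum_univ_castSucc]
    simp only [Fin.val_castSucc, Fin.val_last, ih]
    split_ifs <;> omega

/-- If the window of odd lags `1, 3, …, 2p-1` before `n` meets at most the three values
`v + 1`, `v + 2`, `v + 3`, then its sum is determined by the positions of the two jumps. -/
theorem sum_odd_lags {N A : ℕ → ℕ} (hA : ∀ n, 1 ≤ n → ∀ m, A n ≤ m ↔ n ≤ N m)
    {n p v : ℕ} (hlow : N v + 2 * p ≤ n) (hN : N (v + 1) ≤ N (v + 2))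
    (hhigh : n ≤ N (v + 3)) (hn : N (v + 2) ≤ n) :
    ∑ j : Fin p, A (n - (2 * (j : ℕ) + 1)) =
      p * (v + 1) + min p ((n - N (v + 1)) / 2) + min p ((n - N (v + 2)) / 2) := by
  rw [← sum_fin_ite_odd_lt, ← sum_fin_ite_odd_lt]
  have h : ∀ j : Fin p, A (n - (2 * (j : ℕ) + 1)) = (v + 1) +
      (if 2 * (j : ℕ) + 1 < n - N (v + 1) then 1 else 0) +
      (if 2 * (j : ℕ) + 1 < n - N (v + 2) then 1 else 0) := by
    intro j
    have hj := j.isLt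
    have h1 : 1 ≤ n - (2 * (j : ℕ) + 1) := by omega
    have := hA _ h1 v
    have := hA _ h1 (v + 1)
    have := hA _ h1 (v + 2)
    have := hA _ h1 (v + 3)
    split_ifs <;> omega
  simp only [h, Finset.sum_add_distrib, Finset.sum_const, Finset.card_univ, Fintype.card_fin,
    smul_eq_mul, mul_add]

/-- The nested term with odd lags halves the value, rounding up. -/
theorem odd_lags_half {γ β p : ℕ} (hγ : 0 < γ) (hp : 2 * p = γ + β) {A : ℕ → ℕ}
    (hA : ∀ n, 1 ≤ n → ∀ m, A n ≤ m ↔ n ≤ conollyCount γ β m) {n : ℕ}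
    (hn : conollyCount γ β 2 < n) :
    2 * p ≤ n ∧ ∑ j : Fin p, A (n - (2 * (j : ℕ) + 1)) < n ∧
      A (n - ∑ j : Fin p, A (n - (2 * (j : ℕ) + 1))) = (A n + 1) / 2 := by
  have hn1 : 1 ≤ n := by omega
  have h2 := hA n hn1 2
  obtain ⟨v, hv⟩ : ∃ v, A n = v + 3 := ⟨A n - 3, by omega⟩
  have hhigh := (hA n hn1 (v + 3)).1 hv.le
  have hlow : conollyCount γ β (v + 2) < n := by
    have := hA n hn1 (v + 2)
    omega
  -- For `A n = 2q + 3`, put r = n - N(2q + 2), so 0 < r ≤ γ; the outer argument is N(q + 1) + r -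
  -- ⌊r/2⌋, which lies in the block of q + 2. The even case is similar.
  obtain ⟨q, rfl | rfl⟩ := Nat.even_or_odd' v
  · have e0 := conollyCount_two_mul γ β q
    have e1 := conollyCount_two_mul_add_one γ β q
    have e2 : conollyCount γ β (2 * q + 2) = _ := conollyCount_two_mul γ β (q + 1)
    have e3 : conollyCount γ β (2 * q + 3) = _ := conollyCount_two_mul_add_one γ β (q + 1)
    have e4 := conollyCount_succ γ β q
    have e5 := conollyCount_succ γ β (q + 1)
    have f1 := le_conollyFreq γ β (q + 1)
    have f2 := le_conollyFreq γ β (q + 1 + 1)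
    rw [← hp] at e0 e1 e2 e3
    have hs := sum_odd_lags hA (n := n) (p := p) (v := 2 * q) (by nlinarith) (by nlinarith)
      hhigh hlow.le
    have hm : p * (2 * q + 1) = 2 * p * q + p := by ring
    have hm' : 2 * p * (q + 1) = 2 * p * q + 2 * p := by ring
    rw [hm] at hs
    rw [hm'] at e2 e3
    generalize 2 * p * q = P at *
    generalize ∑ j : Fin p, A (n - (2 * (j : ℕ) + 1)) = S at *
    have hS : S < n := by omega
    refine ⟨by omega, hS, ?_⟩
    have a1 := hA (n - S) (by omega) (q + 1)
    have a2 := hA (n - S) (by omega) (q + 1 + 1)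
    omega
  · have e0 := conollyCount_two_mul_add_one γ β q
    have e1 : conollyCount γ β (2 * q + 1 + 1) = _ := conollyCount_two_mul γ β (q + 1)
    have e2 : conollyCount γ β (2 * q + 1 + 2) = _ := conollyCount_two_mul_add_one γ β (q + 1)
    have e3 : conollyCount γ β (2 * q + 1 + 3) = _ := conollyCount_two_mul γ β (q + 1 + 1)
    have e4 := conollyCount_succ γ β q
    have e5 := conollyCount_succ γ β (q + 1)
    have f1 := le_conollyFreq γ β (q + 1)
    have f2 := le_conollyFreq γ β (q + 1 + 1)
    rw [← hp] at e0 e1 e2 e3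
    have hs := sum_odd_lags hA (n := n) (p := p) (v := 2 * q + 1) (by nlinarith) (by nlinarith)
      hhigh hlow.le
    have hm : p * (2 * q + 1 + 1) = 2 * p * q + 2 * p := by ring
    have hm' : 2 * p * (q + 1) = 2 * p * q + 2 * p := by ring
    have hm'' : 2 * p * (q + 1 + 1) = 2 * p * q + 4 * p := by ring
    rw [hm] at hs
    rw [hm'] at e1 e2
    rw [hm''] at e3
    generalize 2 * p * q = P at *
    generalize ∑ j : Fin p, A (n - (2 * (j : ℕ) + 1)) = S at *
    have hS : S < n := by omega
    refine ⟨by omega, hS, ?_⟩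
    have a1 := hA (n - S) (by omega) (q + 1)
    have a2 := hA (n - S) (by omega) (q + 1 + 1)
    omega

/-- Going back by `γ` turns rounding up into rounding down. -/
theorem half_sub_eq {γ β : ℕ} (hγ : 0 < γ) {A : ℕ → ℕ}
    (hA : ∀ n, 1 ≤ n → ∀ m, A n ≤ m ↔ n ≤ conollyCount γ β m) {n : ℕ} (hn : γ < n) :
    (A (n - γ) + 1) / 2 = A n / 2 := by
  have hn1 : 1 ≤ n := by omega
  have h1 := conollyCount_two_mul_add_one γ β 0
  simp only [conollyCount_zero, mul_zero, zero_add] at h1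
  have h0 := hA n hn1 1
  obtain ⟨v, hv⟩ : ∃ v, A n = v + 2 := ⟨A n - 2, by omega⟩
  have b1 := hA n hn1 (v + 1)
  have b2 := hA n hn1 (v + 2)
  have a0 := hA (n - γ) (by omega) v
  have a1 := hA (n - γ) (by omega) (v + 1)
  have a2 := hA (n - γ) (by omega) (v + 2)
  have c1 := conollyCount_succ γ β v
  have c2 : conollyCount γ β (v + 2) = _ := conollyCount_succ γ β (v + 1)
  have f1 := le_conollyFreq γ β (v + 1)
  -- Odd values fill blocks of length exactly γ: from an odd `A n` the shift lands on `A n - 1`,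
  -- from an even one on `A n` or `A n - 1`.
  obtain ⟨q, rfl | rfl⟩ := Nat.even_or_odd' v
  · have := conollyFreq_odd γ β q
    omega
  · have : conollyFreq γ β (2 * q + 1 + 1 + 1) = γ := conollyFreq_odd γ β (q + 1)
    have a3 := hA (n - γ) (by omega) (2 * q)
    have c0 := conollyCount_succ γ β (2 * q)
    omega

theorem oddLagRecursion_isConolly {α β : ℤ} {γ b p : ℕ} (hγ : 0 < γ) (hα : α + β = γ)
    (hβ : β = b) (hp : 2 * p = γ + b) : (oddLagRecursion p γ).IsConolly α β := by
  obtain ⟨A, hA⟩ := exists_le_iff_le_conollyCount hγ b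
  have hC := isConollySeq_of_le_iff hα hβ hA
  have hsub : ∀ n j : ℕ, n - (γ + (2 * j + 1)) = n - γ - (2 * j + 1) := fun n j => by omega
  -- Both n and n - γ must exceed N(2).
  refine ⟨conollyCount γ b 2 + γ, A, ⟨fun n hn _ => hC.pos n hn, ?_, ?_, ?_⟩, hC⟩
  · intro n hn i j
    have hj := j.isLt
    have h1 := (odd_lags_half hγ hp hA (n := n) (by omega)).1
    have h2 := (odd_lags_half hγ hp hA (n := n - γ) (by omega)).1
    fin_cases i <;> simp [oddLagRecursion] <;> omega
  · intro n hn i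
    have h1 := (odd_lags_half hγ hp hA (n := n) (by omega)).2.1
    have h2 := (odd_lags_half hγ hp hA (n := n - γ) (by omega)).2.1
    fin_cases i
    · simpa [oddLagRecursion] using h1
    · simp only [oddLagRecursion, Fin.mk_one, Matrix.cons_val_one, Matrix.cons_val_fin_one, hsub]
      omega
  · intro n hn
    have h1 := (odd_lags_half hγ hp hA (n := n) (by omega)).2.2
    have h2 := (odd_lags_half hγ hp hA (n := n - γ) (by omega)).2.2
    have h3 := half_sub_eq hγ hA (n := n) (by omega)
    simp only [oddLagRecursion, Fin.sum_univ_two, Matrix.cons_val_zero, Matrix.cons_val_one,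
      Matrix.cons_val_fin_one, hsub, zero_add]
    rw [Nat.sub_add_eq, h1, h2, h3]
    omega

/-! ### Necessity: asymptotics -/

theorem IsConollySeq.frequency_nonneg {α β : ℤ} {A : ℕ → ℕ} (hA : IsConollySeq α β A) :
    0 ≤ β ∧ 0 ≤ α + β := by
  have h1 := hA.frequency 1 le_rfl
  simp only [ruler, padicValNat_one_right, zero_add, Nat.cast_one, mul_one] at h1
  have h0 : 0 ≤ α + β := h1 ▸ Int.natCast_nonneg _
  refine ⟨?_, h0⟩
  by_contra! hβ
  -- If β ≤ -1, this m would have frequency (α + β) + β(α + β + 1) ≤ -1.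
  have hk := hA.frequency (2 ^ (α + β + 1).toNat) Nat.one_le_two_pow
  rw [ruler, padicValNat.prime_pow] at hk
  push_cast at hk
  rw [Int.toNat_of_nonneg (by omega)] at hk
  have : 0 ≤ α + β * (α + β + 1 + 1) := hk ▸ Int.natCast_nonneg _
  nlinarith

theorem exists_mul_lt_two_pow (C : ℕ) : ∃ k, C * (k + 1) < 2 ^ k := by
  have h : ∀ k, 4 * k < 2 ^ (k + 5) := fun k => by
    have := Nat.lt_two_pow_self (n := k)
    rw [pow_add]; omega
  refine ⟨2 * (C + 5), ?_⟩
  have h1 : C + 5 < 2 ^ (C + 5) := Nat.lt_two_pow_self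
  have h2 := h C
  rw [two_mul, pow_add]
  nlinarith

/-- A Conolly sequence grows linearly, up to a logarithmic error. -/
theorem abs_sub_mul_le {γ β : ℕ} (hγ : 0 < γ) {A : ℕ → ℕ}
    (hA : ∀ n, 1 ≤ n → ∀ m, A n ≤ m ↔ n ≤ conollyCount γ β m) {n k : ℕ} (hn : 1 ≤ n)
    (hk : n < 2 ^ k) : |(n : ℤ) - (γ + β : ℕ) * A n| ≤ (γ + β) * (k + 1) := by
  have hN := conollyCount_strictMono hγ β
  have h0 := hA n hn 0
  rw [conollyCount_zero] at h0
  obtain ⟨m, hm⟩ : ∃ m, A n = m + 1 := ⟨A n - 1, by omega⟩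
  have h1 := hA n hn m
  have h2 := (hA n hn (m + 1)).1 hm.le
  have h3 : conollyCount γ β m < n := by omega
  have h4 : m ≤ conollyCount γ β m := hN.id_le m
  have h5 := le_conollyCount_add γ β k m (by omega)
  have h6 := conollyCount_le γ β (m + 1)
  rw [hm, abs_le]
  zify at h2 h3 h5 h6
  push_cast
  have : (0 : ℤ) ≤ γ * k := by positivity
  have : (0 : ℤ) ≤ (γ + β) * (k + 1) := by positivity
  constructor <;> nlinarith

/-- The scaled outer argument of a recursion whose solution grows like `n / δ`. -/
theorem abs_outer_arg_sub_le {p : ℕ} {δ n E x : ℤ} (s : ℕ) (a : Fin p → ℕ) (y : Fin p → ℤ)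
    (hx : x = n - (s + ∑ j, y j)) (hδ : 0 ≤ δ) (hy : ∀ j, |n - a j - δ * y j| ≤ E) :
    |δ * x - (δ - p) * n| ≤ δ * s + p * E + ∑ j, (a j : ℤ) := by
  have h1 : δ * x - (δ - p) * n = -(δ * s) + ∑ j, (n - a j - δ * y j) + ∑ j, (a j : ℤ) := by
    simp only [Finset.sum_sub_distrib, Finset.sum_const, Finset.card_univ, Fintype.card_fin,
      nsmul_eq_mul, ← Finset.mul_sum]
    rw [hx]; ring
  have h2 : |∑ j, (n - a j - δ * y j)| ≤ p * E := by
    refine (Finset.abs_sum_le_sum_abs _ _).trans ((Finset.sum_le_sum fun j _ => hy j).trans ?_)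
    simp
  have h3 : (0 : ℤ) ≤ ∑ j, (a j : ℤ) := by positivity
  have h4 : 0 ≤ δ * (s : ℤ) := by positivity
  rw [h1]
  rw [abs_le] at h2 ⊢
  constructor <;> linarith [h2.1, h2.2]

theorem two_mul_order_eq {γ β p c : ℕ} (hγ : 0 < γ) {A : ℕ → ℕ}
    (hA : ∀ n, 1 ≤ n → ∀ m, A n ≤ m ↔ n ≤ conollyCount γ β m) {R : MetaFib 2 p}
    (hR : R.IsSolution c A) : 2 * p = γ + β := by
  set δ : ℕ := γ + β with hδ
  -- The 3δ² pays for the errors of A at n and at the two outer arguments, 2pδ for the inner terms.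
  set K : ℕ := 3 * δ * δ + δ * (R.s 0 + R.s 1) + 2 * p * δ + (∑ j, R.a 0 j + ∑ j, R.a 1 j)
    with hK
  obtain ⟨k, hk⟩ := exists_mul_lt_two_pow (K + c + 1)
  -- Being below 2^k, this n lets one error bound serve all m ≤ n.
  obtain ⟨n, hn⟩ : ∃ n, n + 1 = 2 ^ k := ⟨2 ^ k - 1, by have := Nat.one_le_two_pow (n := k); omega⟩
  have hcn : c < n := by nlinarith
  have hKn : K * (k + 1) < n := by nlinarith
  have hlin : ∀ m, 1 ≤ m → m ≤ n → |(m : ℤ) - δ * A m| ≤ δ * (k + 1) := fun m h1 h2 => by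
    have := abs_sub_mul_le hγ hA h1 (k := k) (by omega)
    rw [hδ]; push_cast at this ⊢; exact this
  have hx : ∀ i, |(δ : ℤ) * (n - (R.s i + ∑ j, A (n - R.a i j)) : ℕ) - (δ - p) * n| ≤
      δ * R.s i + p * (δ * (k + 1)) + ∑ j, (R.a i j : ℤ) := fun i => by
    refine abs_outer_arg_sub_le (R.s i) (R.a i) (fun j => (A (n - R.a i j) : ℤ)) ?_
      (by positivity) fun j => ?_
    · rw [Nat.cast_sub (hR.outer_arg_pos n hcn i).le]
      push_cast; rfl
    · have h := hR.inner_arg_pos n hcn i j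
      have := hlin (n - R.a i j) (by omega) (by omega)
      rwa [Nat.cast_sub h.le] at this
  have hAx : ∀ i, |((n - (R.s i + ∑ j, A (n - R.a i j)) : ℕ) : ℤ) -
      δ * A (n - (R.s i + ∑ j, A (n - R.a i j)))| ≤ δ * (k + 1) := fun i => by
    have h := hR.outer_arg_pos n hcn i
    exact hlin _ (by omega) (by omega)
  have hrec := hR.recursion n hcn
  rw [Fin.sum_univ_two] at hrec
  have x0 := hx 0
  have x1 := hx 1
  have y0 := hAx 0
  have y1 := hAx 1
  have y := hlin n (by omega) le_rfl
  generalize n - (R.s 0 + ∑ j, A (n - R.a 0 j)) = u at *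
  generalize n - (R.s 1 + ∑ j, A (n - R.a 1 j)) = v at *
  have hz : |((2 * p : ℤ) - δ) * n| ≤ K * (k + 1) := by
    have e : ((2 * p : ℤ) - δ) * n = δ * (n - δ * A n) - δ * (u - δ * A u) - δ * (v - δ * A v)
        + (δ * u - (δ - p) * n) + (δ * v - (δ - p) * n) := by
      rw [hrec]; push_cast; ring
    have hm : ∀ z : ℤ, |z| ≤ δ * (k + 1) → |δ * z| ≤ δ * (δ * (k + 1)) := fun z hz => by
      rw [abs_mul, Nat.abs_cast]
      exact mul_le_mul_of_nonneg_left hz (by positivity)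
    have hS : δ * (R.s 0 + R.s 1) + (∑ j, R.a 0 j + ∑ j, R.a 1 j) ≤
        (δ * (R.s 0 + R.s 1) + (∑ j, R.a 0 j + ∑ j, R.a 1 j)) * (k + 1) :=
      Nat.le_mul_of_pos_right _ (by omega)
    zify at hS
    have y' := hm _ y
    have y0' := hm _ y0
    have y1' := hm _ y1
    rw [e, hK]
    push_cast
    rw [abs_le] at *
    constructor <;> linarith [y'.1, y'.2, y0'.1, y0'.2, y1'.1, y1'.2, x0.1, x0.2, x1.1, x1.2]
  by_contra hne
  have h1 : 1 ≤ |(2 * p : ℤ) - δ| := Int.one_le_abs (by omega)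
  rw [abs_mul, Nat.abs_cast] at hz
  have : (K * (k + 1) : ℤ) < n := by exact_mod_cast hKn
  nlinarith

theorem mainTheorem1 (α β : ℤ) (hexcl : ¬ (β = -α ∧ 0 < β)) :
    ((∃ p : ℕ, 1 ≤ p ∧ ∃ R : MetaFib 2 p, R.IsConolly α β) ↔
      (0 ≤ β ∧ 0 < α + β ∧ Even α)) ∧
    (0 ≤ β → 0 < α + β → Even α →
      (oddLagRecursion (α / 2 + β).toNat (α + β).toNat).IsConolly α β) := by
  have hsuff : 0 ≤ β → 0 < α + β → Even α →
      (oddLagRecursion (α / 2 + β).toNat (α + β).toNat).IsConolly α β := by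
    rintro hβ hγ ⟨a, ha⟩
    exact oddLagRecursion_isConolly (b := β.toNat) (by omega) (by omega) (by omega) (by omega)
  refine ⟨⟨?_, ?_⟩, hsuff⟩
  · rintro ⟨p, -, R, c, A, hR, hA⟩
    obtain ⟨hβ, hγ⟩ := hA.frequency_nonneg
    have hγ' : 0 < α + β := by
      refine lt_of_le_of_ne hγ fun h0 => ?_
      -- The excluded case leaves only α = β = 0, where even the value `A 1` would never occur.
      have hα0 : α = 0 ∧ β = 0 := by omega
      have hpos := hA.pos 1 le_rfl
      have hf := hA.frequency (A 1) hpos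
      rw [hα0.1, hα0.2, zero_mul, zero_add, Nat.cast_eq_zero,
        Set.ncard_eq_zero (hA.finite_occurrences _ hpos)] at hf
      exact (Set.ext_iff.1 hf 1).1 ⟨le_rfl, rfl⟩
    have h := two_mul_order_eq (γ := (α + β).toNat) (β := β.toNat) (by omega)
      (hA.le_iff_le_conollyCount (by omega) (by omega)) hR
    exact ⟨hβ, hγ', p - β, by omega⟩
  · rintro ⟨hβ, hγ, hα⟩
    exact ⟨_, by obtain ⟨a, ha⟩ := hα; omega, _, hsuff hβ hγ hα⟩
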